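/- For integers $1\le n\le m$ let $\Phi_{m,n}=\{(s_1,\dots,s_m)\in\mathbb{Z}_{\ge 0}^m:\sum_{j=1}^m s_j=n\}$. For a unitary matrix $U\in U(m)$ and $S=(s_1,\dots,s_m)\in\Phi_{m,n}$ let $U_S\in\mathbb{C}^{n\times n}$ be the matrix obtained from $U$ by discarding all but the first $n$ columns and then taking $s_j$ copies of the $j$-th row, for $j=1,\dots,m$. The Boson-Sampling distribution $\mathcal{D}_U$ is the probability distribution on $\Phi_{m,n}$ with $$\Pr_{\mathcal{D}_U}[S]=\frac{|\mathrm{Perm}(U_S)|^2}{\prod_{j=1}^m s_j!}.$$ A symmetric probabilistic algorithm with $l$ samples from a finite set $\Phi$ assigns to every $(x_1,\dots,x_l)\in\Phi^l$ a probability distribution on $\{\text{accept},\text{reject}\}$ which does not change under permutations of the $l$ samples, nor under relabelings $(x_1,\dots,x_l)\mapsto(\kappa(x_1),\dots,\kappa(x_l))$ with $\kappa\in\mathrm{Sym}(\Phi)$. For constants $p,q\in\mathbb{R}$ with $p+q>1$ (for example $p=q=2/3$) we say that it distinguishes a distribution $\mathcal{P}$ from a distribution $\mathcal{Q}$ on $\Phi$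 if it accepts with probability at least $p$ when it receives $l$ independent samples from $\mathcal{P}$ and rejects with probability at least $q$ when it receives $l$ independent samples from $\mathcal{Q}$. **Theorem.** Let $\nu>3$, let $m=m(n)\in\Omega(n^\nu)$, and let $U\in U(m)$ be drawn from the Haar probability measure $\mu_H$. Then, except with probability over $U$ that is supra-exponentially small in $n$, no symmetric probabilistic algorithm can distinguish the Boson-Sampling distribution $\mathcal{D}_U$ from the uniform distribution on $\Phi_{m,n}$ from $O(\mathrm{e}^{n/2})$ many samples. Precisely: for all constants $p,q\in\mathbb{R}$ with $p+q>1$, all $a>0$ and all $C>0$ there is an $n_0$ such that for all $n\ge n_0$ one has $n\le m(n)$ and $$\Pr_{U\sim\mu_H}\Big[\text{there are } l\le a\,\mathrm{e}^{n/2}\text{ and a symmetric probabilistic algorithm with } l \text{ samples that distinguishes } \mathcal{D}_U \text{ from the uniform distribution on } \Phi_{m,n}\Big]\le \mathrm{e}^{-C n}.$$ -/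

import Mathlib

open Filter Asymptotics MeasureTheory

open scoped ENNReal NNReal

namespace BosonSampling

/-! ### The sample space -/

/-- The sample space `Φ_{m,n}`: occupation numbers `(s_1, …, s_m)` with `∑ s_j = n`. -/
def Outcome (m n : ℕ) : Type := {s : Fin m → ℕ // ∑ j, s j = n}

noncomputable instance (m n : ℕ) : Fintype (Outcome m n) :=
  Fintype.subtype (Finset.piAntidiag Finset.univ n) (fun s => by simp)

instance (m n : ℕ) : DecidableEq (Outcome m n) :=
  inferInstanceAs (DecidableEq {s : Fin m → ℕ // ∑ j, s j = n})

/-- The outcome `1_n = (1, …, 1, 0, …, 0)` (the first `n` of the `m` modes occupied once). -/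
def initialOutcome {m n : ℕ} (h : n ≤ m) : Outcome m n :=
  ⟨fun j => if (j : ℕ) < n then 1 else 0, by
    rw [Fin.sum_univ_eq_sum_range (fun j => if j < n then 1 else 0) m,
      ← Finset.sum_filter, Finset.sum_const, smul_eq_mul, mul_one]
    have : Finset.filter (fun j => j < n) (Finset.range m) = Finset.range n := by
      ext j
      simp only [Finset.mem_filter, Finset.mem_range]
      omega
    rw [this, Finset.card_range]⟩

/-- The uniform distribution on `Φ_{m,n}`. -/
noncomputable def uniform {m n : ℕ} (h : n ≤ m) : PMF (Outcome m n) :=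
  haveI : Nonempty (Outcome m n) := ⟨initialOutcome h⟩
  PMF.uniformOfFintype (Outcome m n)

/-! ### The Boson-Sampling distribution -/

/-- The sequence of length `n` listing the mode `1` with multiplicity `s_1`, then the mode `2`
with multiplicity `s_2`, and so on. -/
def rowSeq {m n : ℕ} (S : Outcome m n) (i : Fin n) : Fin m :=
  (finSigmaFinEquiv.symm (Fin.cast S.2.symm i)).1

/-- The `n × n` matrix `U_S`: keep only the first `n` columns of `U` and, for every mode `j`, take
`s_j` copies of the `j`-th row. -/
def submatrix {m n : ℕ} (h : n ≤ m) (U : Matrix.unitaryGroup (Fin m) ℂ) (S : Outcome m n) :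
    Matrix (Fin n) (Fin n) ℂ :=
  Matrix.of fun i k => (U : Matrix (Fin m) (Fin m) ℂ) (rowSeq S i) (Fin.castLE h k)

/-- The probability `|Perm(U_S)|² / ∏_j s_j!` of the outcome `S`. -/
noncomputable def outcomeProb {m n : ℕ} (h : n ≤ m) (U : Matrix.unitaryGroup (Fin m) ℂ)
    (S : Outcome m n) : ℝ :=
  ‖(submatrix h U S).permanent‖ ^ 2 / ∏ j, ((S.1 j).factorial : ℝ)

/-- The occupation numbers of a sequence of modes. -/
def occupation {m n : ℕ} (f : Fin n → Fin m) : Outcome m n :=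
  ⟨fun j => Fintype.card {i // f i = j}, by
    rw [← Fintype.card_sigma, Fintype.card_congr (Equiv.sigmaFiberEquiv f), Fintype.card_fin]⟩

theorem occupation_rowSeq {m n : ℕ} (S : Outcome m n) : occupation (rowSeq S) = S := by
  apply Subtype.ext
  funext j
  obtain ⟨s, rfl⟩ := S
  change Fintype.card {i : Fin (∑ j, s j) // (finSigmaFinEquiv.symm i).1 = j} = s j
  have e : {i : Fin (∑ j, s j) // (finSigmaFinEquiv.symm i).1 = j} ≃
      {x : (i : Fin m) × Fin (s i) // x.1 = j} :=
    Equiv.subtypeEquiv finSigmaFinEquiv.symm (fun _ => Iff.rfl)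
  rw [Fintype.card_congr e, Fintype.card_congr (Equiv.sigmaSubtype j), Fintype.card_fin]

theorem exists_perm_of_occupation_eq {m n : ℕ} {f g : Fin n → Fin m}
    (h : occupation f = occupation g) : ∃ σ : Equiv.Perm (Fin n), f ∘ σ = g := by
  have hc : ∀ j, Nonempty ({i // g i = j} ≃ {i // f i = j}) := fun j =>
    Fintype.card_eq.1 (congrFun (congrArg Subtype.val h) j).symm
  refine ⟨(Equiv.sigmaFiberEquiv g).symm.trans
    ((Equiv.sigmaCongrRight fun j => (hc j).some).trans (Equiv.sigmaFiberEquiv f)), ?_⟩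
  funext i
  exact ((hc (g i)).some ⟨i, rfl⟩).2

theorem card_fiber_mul {m n : ℕ} (f : Fin n → Fin m) (v : (Fin n → Fin m) → ℝ)
    (hv : ∀ (g : Fin n → Fin m) (σ : Equiv.Perm (Fin n)), v (g ∘ σ) = v g) :
    (∑ g with occupation g = occupation f, v g) * ∏ j, (((occupation f).1 j).factorial : ℝ) =
      n.factorial * v f := by
  classical
  have h1 : ∑ σ : Equiv.Perm (Fin n), v (f ∘ σ) = n.factorial * v f := by
    simp [hv, Fintype.card_perm]
  have hocc : ∀ σ : Equiv.Perm (Fin n), occupation (f ∘ σ) = occupation f := by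
    intro σ
    apply Subtype.ext
    funext j
    exact Fintype.card_congr (Equiv.subtypeEquiv (p := fun i => (f ∘ σ) i = j)
      (q := fun i => f i = j) σ (fun _ => Iff.rfl))
  rw [← h1, ← Finset.sum_fiberwise_of_maps_to (s := Finset.univ)
    (t := Finset.univ.filter fun g => occupation g = occupation f)
    (g := fun σ : Equiv.Perm (Fin n) => f ∘ σ) (by simp [hocc]), Finset.sum_mul]
  refine Finset.sum_congr rfl fun g hg => ?_
  rw [Finset.mem_filter] at hg
  obtain ⟨τ, rfl⟩ := exists_perm_of_occupation_eq hg.2.symm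
  have h2 : ∀ σ ∈ Finset.univ.filter (fun σ : Equiv.Perm (Fin n) => f ∘ σ = f ∘ τ),
      v (f ∘ σ) = v (f ∘ τ) := by
    intro σ hσ
    rw [(Finset.mem_filter.1 hσ).2]
  rw [Finset.sum_congr rfl h2, Finset.sum_const, nsmul_eq_mul, mul_comm]
  congr 1
  have h3 : (Finset.univ.filter (fun σ : Equiv.Perm (Fin n) => f ∘ σ = f ∘ τ)).card =
      Fintype.card {σ : Equiv.Perm (Fin n) // f ∘ σ = f} := by
    rw [← Fintype.card_subtype]
    refine Fintype.card_congr (Equiv.subtypeEquiv (Equiv.mulRight τ⁻¹) fun σ => ?_)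
    constructor
    · intro h
      funext i
      simpa using congrFun h (τ⁻¹ i)
    · intro h
      funext i
      simpa using congrFun h (τ i)
  rw [h3, DomMulAct.stabilizer_card]
  push_cast
  rfl

theorem sum_permanent_sq {m n : ℕ} (h : n ≤ m) (U : Matrix.unitaryGroup (Fin m) ℂ) :
    ∑ f : Fin n → Fin m, ‖(Matrix.of fun i k : Fin n =>
      (U : Matrix (Fin m) (Fin m) ℂ) (f i) (Fin.castLE h k)).permanent‖ ^ 2 = n.factorial := by
  classical
  have horth : ∀ a b : Fin m, ∑ r, (U : Matrix (Fin m) (Fin m) ℂ) r a *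
      star ((U : Matrix (Fin m) (Fin m) ℂ) r b) = if a = b then 1 else 0 := by
    intro a b
    have hU := congrFun (congrFun (Matrix.mem_unitaryGroup_iff'.1 U.2) b) a
    rw [Matrix.mul_apply, Matrix.one_apply] at hU
    rw [← (show (if b = a then (1 : ℂ) else 0) = if a = b then 1 else 0 by
      simp only [eq_comm]), ← hU]
    exact Finset.sum_congr rfl fun r _ => by rw [Matrix.star_apply, mul_comm]
  have hre : ∀ (f : Fin n → Fin m) (σ : Equiv.Perm (Fin n)),
      ∏ k, (U : Matrix (Fin m) (Fin m) ℂ) (f (σ k)) (Fin.castLE h k) =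
        ∏ i, (U : Matrix (Fin m) (Fin m) ℂ) (f i) (Fin.castLE h (σ⁻¹ i)) := by
    intro f σ
    rw [← Equiv.prod_comp σ
      (fun i => (U : Matrix (Fin m) (Fin m) ℂ) (f i) (Fin.castLE h (σ⁻¹ i)))]
    simp
  have key : ∑ f : Fin n → Fin m, (Matrix.of fun i k : Fin n =>
      (U : Matrix (Fin m) (Fin m) ℂ) (f i) (Fin.castLE h k)).permanent *
      star ((Matrix.of fun i k : Fin n =>
      (U : Matrix (Fin m) (Fin m) ℂ) (f i) (Fin.castLE h k)).permanent) = n.factorial := by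
    simp only [Matrix.permanent, Matrix.of_apply, hre, star_sum, star_prod, Finset.sum_mul_sum,
      ← Finset.prod_mul_distrib]
    rw [Finset.sum_comm]
    have : ∀ σ : Equiv.Perm (Fin n), ∑ f : Fin n → Fin m, ∑ τ : Equiv.Perm (Fin n),
        ∏ i, ((U : Matrix (Fin m) (Fin m) ℂ) (f i) (Fin.castLE h (σ⁻¹ i)) *
          star ((U : Matrix (Fin m) (Fin m) ℂ) (f i) (Fin.castLE h (τ⁻¹ i)))) = 1 := by
      intro σ
      rw [Finset.sum_comm, Finset.sum_eq_single σ]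
      · have := (Finset.prod_univ_sum (fun _ : Fin n => (Finset.univ : Finset (Fin m)))
          (fun i r => (U : Matrix (Fin m) (Fin m) ℂ) r (Fin.castLE h (σ⁻¹ i)) *
            star ((U : Matrix (Fin m) (Fin m) ℂ) r (Fin.castLE h (σ⁻¹ i))))).symm
        rw [Fintype.piFinset_univ] at this
        rw [this]
        exact Finset.prod_eq_one fun i _ => by rw [horth, if_pos rfl]
      · intro τ _ hτ
        have := (Finset.prod_univ_sum (fun _ : Fin n => (Finset.univ : Finset (Fin m)))
          (fun i r => (U : Matrix (Fin m) (Fin m) ℂ) r (Fin.castLE h (σ⁻¹ i)) *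
            star ((U : Matrix (Fin m) (Fin m) ℂ) r (Fin.castLE h (τ⁻¹ i))))).symm
        rw [Fintype.piFinset_univ] at this
        rw [this]
        have hne : ∃ i, σ⁻¹ i ≠ τ⁻¹ i := by
          by_contra! hcon
          exact hτ (inv_injective (Equiv.ext fun i => (hcon i).symm))
        obtain ⟨i, hi⟩ := hne
        refine Finset.prod_eq_zero (Finset.mem_univ i) ?_
        rw [horth, if_neg]
        exact fun hc => hi (Fin.castLE_injective h hc)
      · simp
    rw [Finset.sum_congr rfl fun σ _ => this σ]
    simp [Fintype.card_perm]
  have hc : ∀ z : ℂ, z * star z = ((‖z‖ ^ 2 : ℝ) : ℂ) := by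
    intro z
    rw [Complex.star_def, Complex.mul_conj, Complex.normSq_eq_norm_sq]
  simp only [hc] at key
  exact_mod_cast key

/-- The probabilities of all outcomes add up to `1`. -/
theorem sum_outcomeProb {m n : ℕ} (h : n ≤ m) (U : Matrix.unitaryGroup (Fin m) ℂ) :
    ∑ S, outcomeProb h U S = 1 := by
  classical
  set v : (Fin n → Fin m) → ℝ := fun f => ‖(Matrix.of fun i k : Fin n =>
      (U : Matrix (Fin m) (Fin m) ℂ) (f i) (Fin.castLE h k)).permanent‖ ^ 2 with hvdef
  have hv : ∀ (g : Fin n → Fin m) (σ : Equiv.Perm (Fin n)), v (g ∘ σ) = v g := by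
    intro g σ
    simp only [hvdef, Matrix.permanent, Matrix.of_apply, Function.comp]
    congr 2
    exact Equiv.sum_comp (Equiv.mulLeft σ) (fun τ : Equiv.Perm (Fin n) =>
      ∏ k, (U : Matrix (Fin m) (Fin m) ℂ) (g (τ k)) (Fin.castLE h k))
  have hn : (n.factorial : ℝ) ≠ 0 := by exact_mod_cast n.factorial_ne_zero
  have hS : ∀ S : Outcome m n, outcomeProb h U S =
      (∑ g with occupation g = S, v g) / n.factorial := by
    intro S
    have hpos : (∏ j, ((S.1 j).factorial : ℝ)) ≠ 0 :=
      Finset.prod_ne_zero_iff.2 fun j _ => by exact_mod_cast (S.1 j).factorial_ne_zero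
    have := card_fiber_mul (rowSeq S) v hv
    rw [occupation_rowSeq] at this
    rw [eq_div_iff hn, outcomeProb, div_mul_eq_mul_div, div_eq_iff hpos, this, mul_comm]
    rfl
  simp only [hS]
  rw [← Finset.sum_div, Finset.sum_fiberwise Finset.univ occupation v, sum_permanent_sq h U, div_self hn]

/-- The Boson-Sampling distribution `D_U` on `Φ_{m,n}`. -/
noncomputable def distribution {m n : ℕ} (h : n ≤ m) (U : Matrix.unitaryGroup (Fin m) ℂ) :
    PMF (Outcome m n) :=
  PMF.ofFintype (fun S => ENNReal.ofReal (outcomeProb h U S)) (by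
    rw [← ENNReal.ofReal_sum_of_nonneg, sum_outcomeProb, ENNReal.ofReal_one]
    intro S _
    unfold outcomeProb
    positivity)

/-! ### The Haar measure on the unitary group -/

/-- The Borel σ-algebra on `U(m)`. -/
noncomputable instance (m : ℕ) : MeasurableSpace (Matrix.unitaryGroup (Fin m) ℂ) := borel _

instance (m : ℕ) : BorelSpace (Matrix.unitaryGroup (Fin m) ℂ) := ⟨rfl⟩

instance (m : ℕ) : CompactSpace (Matrix.unitaryGroup (Fin m) ℂ) := by
  have hcl : IsClosed (Matrix.unitaryGroup (Fin m) ℂ : Set (Matrix (Fin m) (Fin m) ℂ)) :=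
    isClosed_unitary
  have hK : IsCompact (Set.univ.pi fun _ : Fin m => Set.univ.pi fun _ : Fin m =>
      Metric.closedBall (0 : ℂ) 1) :=
    isCompact_univ_pi fun _ => isCompact_univ_pi fun _ => isCompact_closedBall 0 1
  exact isCompact_iff_compactSpace.1 (hK.of_isClosed_subset hcl fun U hU => by
    intro i _ j _
    simpa using entry_norm_bound_of_unitary hU i j)

/-- The Haar probability measure on `U(m)` (normalized to total mass `1`). -/
noncomputable def haar (m : ℕ) : Measure (Matrix.unitaryGroup (Fin m) ℂ) :=
  Measure.haarMeasure ⊤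

/-! ### Probabilistic decision algorithms in the black box setting -/

/-- A probabilistic decision algorithm taking `l` samples from `Φ`: for every sequence of samples
a probability distribution on the answers `true` ("accept") and `false` ("reject"). -/
abbrev DecisionAlgorithm (Φ : Type) (l : ℕ) : Type := (Fin l → Φ) → PMF Bool

/-- A decision algorithm is symmetric if its output distribution is invariant under permuting the
samples and under relabeling the sample space. -/
def DecisionAlgorithm.IsSymmetric {Φ : Type} {l : ℕ} (A : DecisionAlgorithm Φ l) : Prop :=
  (∀ (x : Fin l → Φ) (τ : Equiv.Perm (Fin l)), A (fun i => x (τ i)) = A x) ∧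
    ∀ (x : Fin l → Φ) (κ : Equiv.Perm Φ), A (fun i => κ (x i)) = A x

/-- The law of `l` independent samples from `P`. -/
noncomputable def iid {Φ : Type} [Fintype Φ] (P : PMF Φ) (l : ℕ) : PMF (Fin l → Φ) :=
  PMF.ofFintype (fun x => ∏ i, P (x i)) (by
    classical
    have := (Finset.prod_univ_sum (fun _ : Fin l => (Finset.univ : Finset Φ))
      (fun _ y => P y)).symm
    rw [Fintype.piFinset_univ] at this
    rw [this, Finset.prod_eq_one]
    intro _ _
    rw [← tsum_fintype (L := .unconditional Φ), P.tsum_coe])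

/-- The output distribution of the algorithm when it receives `l` independent samples from `P`. -/
noncomputable def DecisionAlgorithm.output {Φ : Type} [Fintype Φ] {l : ℕ}
    (A : DecisionAlgorithm Φ l) (P : PMF Φ) : PMF Bool :=
  (iid P l).bind A

/-- The algorithm accepts samples from `P` with probability at least `p` and rejects samples from
`Q` with probability at least `q`. -/
def DecisionAlgorithm.Distinguishes {Φ : Type} [Fintype Φ] {l : ℕ}
    (A : DecisionAlgorithm Φ l) (p q : ℝ) (P Q : PMF Φ) : Prop :=
  p ≤ (A.output P true).toReal ∧ q ≤ (A.output Q false).toReal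

end BosonSampling

/-!
A symmetric algorithm learns nothing from a sequence of pairwise distinct samples: any two such
sequences differ by a relabeling of the sample space, so the output distribution is the same on all
of them. Telling two distributions apart thus needs a collision among the samples of one of them,
and if all probabilities are at most `ε`, then `l` samples collide with probability at most `l² ε`.
Hence `p + q ≤ 1 + 2 l² ε` (`DecisionAlgorithm.Distinguishes.add_le`). With `l ≤ a e^{n/2}` and
`ε = e^{-2n}` the right-hand side tends to `1`.

It remains to see that `D_U` is this flat for most `U`. If all entries of `U` have norm at most
`e^{-1} / n`, then `|Perm(U_S)| ≤ n! (e^{-1} / n)^n ≤ e^{-n}`, so every outcome has probability at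
most `e^{-2n}` (`distribution_le`). The uniform distribution minimizes the largest probability, so
its probabilities obey the same bound (`uniform_apply_le`).

Large entries are rare (`haar_exists_lt_norm_entry_le`). For signs `σ_k = ±1` there is a unitary
matrix whose `i`-th row is `σ_k / √m`. By invariance of the Haar measure, `U_{ij}` has the law of
`∑_k σ_k U_{kj} / √m`. Averaging over the signs and using `cosh x ≤ e^{x²/2}` shows that
`Re (c U_{ij})` is sub-Gaussian with variance proxy `1 / m` for `|c| = 1`
(`lintegral_exp_entry_le`). By Chernoff's bound and a union bound over the entries, some entry
exceeds `e^{-1} / n` with probability at most `4 m² exp (-m / (8 e² n²))`, which is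
supra-exponentially small since `m / n² ≥ c n^{ν - 2}` with `ν - 2 > 1`.
-/

namespace BosonSampling

/-! ### Symmetric algorithms and collisions -/

/-- The birthday bound: `l` independent samples from `P` contain a collision with probability at
most `l² ε` if no outcome has probability more than `ε`. -/
lemma sum_not_injective_prod_le {Φ : Type} [Fintype Φ] [DecidableEq Φ] (P : Φ → ℝ≥0∞)
    (hP : ∑ y, P y = 1) (ε : ℝ≥0∞) (hε : ∀ y, P y ≤ ε) (l : ℕ) :
    ∑ x : Fin l → Φ with ¬ Function.Injective x, ∏ i, P (x i) ≤ (l : ℝ≥0∞) ^ 2 * ε := by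
  have hsum : ∀ l : ℕ, ∑ x : Fin l → Φ, ∏ i, P (x i) = 1 := fun l => by
    rw [← Fintype.piFinset_univ, ← Finset.prod_univ_sum]
    simp [hP]
  induction l with
  | zero =>
    rw [Finset.filter_false_of_mem]
    · simp
    · intro x _
      simpa using Function.injective_of_subsingleton x
  | succ l ih =>
    have hmem : ∀ x : Fin l → Φ, ∑ y, (if y ∈ Set.range x then P y else 0) ≤ l * ε := by
      intro x
      classical
      rw [← Finset.sum_filter]
      calc ∑ y with y ∈ Set.range x, P y ≤ ∑ y ∈ Finset.univ.image x, P y :=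
            Finset.sum_le_sum_of_subset fun y hy => by simpa using hy
        _ ≤ (Finset.univ.image x).card • ε := Finset.sum_le_card_nsmul _ _ _ fun y _ => hε y
        _ ≤ l * ε := by
            rw [nsmul_eq_mul]
            gcongr
            simpa using Finset.card_image_le (s := (Finset.univ : Finset (Fin l))) (f := x)
    have hcons : ∀ F : (Fin (l + 1) → Φ) → ℝ≥0∞,
        ∑ x, F x = ∑ x : Fin l → Φ, ∑ y, F (Fin.cons y x) := by
      intro F
      rw [← (Fin.consEquiv fun _ => Φ).sum_comp F, Fintype.sum_prod_type, Finset.sum_comm]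
      rfl
    classical
    rw [Finset.sum_filter, hcons]
    -- A collision among `l + 1` samples is one among the last `l`, or the first sample repeats one
    -- of them; the latter has conditional probability at most `l * ε`.
    calc ∑ x : Fin l → Φ, ∑ y, (if ¬ Function.Injective (Fin.cons y x : Fin (l + 1) → Φ) then
            ∏ i, P ((Fin.cons y x : Fin (l + 1) → Φ) i) else 0)
        ≤ ∑ x : Fin l → Φ, ∑ y, ((if ¬ Function.Injective x then P y * ∏ i, P (x i) else 0) +
            (if y ∈ Set.range x then P y else 0) * ∏ i, P (x i)) := by
          gcongr with x _ y _
          simp only [Fin.cons_injective_iff, Fin.prod_univ_succ, Fin.cons_zero, Fin.cons_succ]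
          by_cases h1 : y ∈ Set.range x <;> by_cases h2 : Function.Injective x <;>
            simp only [h1, h2] <;> simp
      _ = ∑ x : Fin l → Φ, (if ¬ Function.Injective x then ∏ i, P (x i) else 0) +
            ∑ x : Fin l → Φ, (∑ y, (if y ∈ Set.range x then P y else 0)) * ∏ i, P (x i) := by
          rw [← Finset.sum_add_distrib]
          refine Finset.sum_congr rfl fun x _ => ?_
          rw [Finset.sum_add_distrib, Finset.sum_mul]
          congr 1
          by_cases h2 : Function.Injective x
          · simp [h2]
          · simp [h2, ← Finset.sum_mul, hP]
      _ ≤ (l : ℝ≥0∞) ^ 2 * ε + ∑ x : Fin l → Φ, l * ε * ∏ i, P (x i) := by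
          rw [← Finset.sum_filter]
          gcongr with x _
          exact hmem x
      _ = (l ^ 2 + l) * ε := by rw [← Finset.mul_sum, hsum]; ring
      _ ≤ ((l + 1 : ℕ) : ℝ≥0∞) ^ 2 * ε := by
          gcongr
          exact_mod_cast (by nlinarith : l ^ 2 + l ≤ (l + 1) ^ 2)

lemma exists_perm_comp_eq {Φ ι : Type} [Finite Φ] {x y : ι → Φ}
    (hx : Function.Injective x) (hy : Function.Injective y) :
    ∃ κ : Equiv.Perm Φ, ∀ i, κ (x i) = y i := by
  classical
  have := Fintype.ofFinite Φ
  let e : {z // z ∈ Set.range x} ≃ {z // z ∈ Set.range y} :=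
    (Equiv.ofInjective x hx).symm.trans (Equiv.ofInjective y hy)
  refine ⟨e.extendSubtype, fun i => ?_⟩
  rw [Equiv.extendSubtype_apply_of_mem e (x i) ⟨i, rfl⟩]
  change (Equiv.ofInjective y hy ((Equiv.ofInjective x hx).symm (Equiv.ofInjective x hx i)) : Φ) = _
  rw [Equiv.symm_apply_apply, Equiv.ofInjective_apply]

/-- If the algorithm answers `b` with probability at most `c` on collision-free inputs, then it
answers `b` on samples from `P` with probability at most `c` plus the bound on the probability of a
collision. -/
lemma output_le {Φ : Type} [Fintype Φ] {l : ℕ} (A : DecisionAlgorithm Φ l)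
    (P : PMF Φ) (b : Bool) (c ε : ℝ≥0∞) (hε : ∀ y, P y ≤ ε)
    (hc : ∀ x, Function.Injective x → A x b ≤ c) :
    A.output P b ≤ c + (l : ℝ≥0∞) ^ 2 * ε := by
  classical
  have hP : ∑ y, P y = 1 := by
    rw [← tsum_fintype (L := .unconditional Φ), P.tsum_coe]
  have hsum : ∑ x : Fin l → Φ, iid P l x = 1 := by
    rw [← tsum_fintype (L := .unconditional _), (iid P l).tsum_coe]
  rw [DecisionAlgorithm.output, PMF.bind_apply, tsum_fintype,
    ← Finset.sum_filter_add_sum_filter_not _ (fun x : Fin l → Φ => Function.Injective x)]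
  gcongr
  · calc ∑ x : Fin l → Φ with Function.Injective x, iid P l x * A x b
        ≤ ∑ x : Fin l → Φ with Function.Injective x, iid P l x * c :=
          Finset.sum_le_sum fun x hx => by gcongr; exact hc x (Finset.mem_filter.1 hx).2
      _ ≤ ∑ x : Fin l → Φ, iid P l x * c :=
          Finset.sum_le_sum_of_subset (Finset.filter_subset _ _)
      _ = c := by rw [← Finset.sum_mul, hsum, one_mul]
  · refine le_trans (Finset.sum_le_sum fun x _ => ?_) (sum_not_injective_prod_le P hP ε hε l)
    exact (mul_le_of_le_one_right' (PMF.coe_le_one _ _)).trans_eq rfl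

/-- Distinguishing two distributions without large probabilities by a symmetric algorithm takes
many samples. -/
theorem DecisionAlgorithm.Distinguishes.add_le {Φ : Type} [Fintype Φ] {l : ℕ}
    {A : DecisionAlgorithm Φ l} (hA : A.IsSymmetric) {p q : ℝ} {P Q : PMF Φ}
    (h : A.Distinguishes p q P Q) {ε : ℝ} (hε : 0 ≤ ε) (hP : ∀ y, P y ≤ ENNReal.ofReal ε)
    (hQ : ∀ y, Q y ≤ ENNReal.ofReal ε) : p + q ≤ 1 + 2 * (l : ℝ) ^ 2 * ε := by
  -- `c` and `d` are the constant probabilities of accepting and rejecting collision-free inputs.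
  -- With more samples than outcomes there is no such input, and `0` serves for both.
  obtain ⟨c, d, hcd, hc, hd⟩ : ∃ c d : ℝ≥0∞, c + d ≤ 1 ∧
      (∀ x, Function.Injective x → A x true ≤ c) ∧
      (∀ x, Function.Injective x → A x false ≤ d) := by
    by_cases hex : ∃ x : Fin l → Φ, Function.Injective x
    · obtain ⟨x₀, hx₀⟩ := hex
      have key : ∀ x, Function.Injective x → A x = A x₀ := fun x hx => by
        obtain ⟨κ, hκ⟩ := exists_perm_comp_eq hx hx₀
        rw [← hA.2 x κ]
        simp only [hκ]
      refine ⟨A x₀ true, A x₀ false, ?_, fun x hx => (key x hx ▸ le_rfl),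
        fun x hx => (key x hx ▸ le_rfl)⟩
      have := (A x₀).tsum_coe
      rw [tsum_fintype, Fintype.sum_bool] at this
      exact this.le
    · push Not at hex
      exact ⟨0, 0, by simp, fun x hx => absurd hx (hex x), fun x hx => absurd hx (hex x)⟩
  have h1 := output_le A P true c _ hP hc
  have h2 := output_le A Q false d _ hQ hd
  have h3 : A.output P true + A.output Q false ≤ ENNReal.ofReal (1 + 2 * (l : ℝ) ^ 2 * ε) := by
    calc _ ≤ (c + (l : ℝ≥0∞) ^ 2 * ENNReal.ofReal ε) + (d + (l : ℝ≥0∞) ^ 2 * ENNReal.ofReal ε) :=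
          add_le_add h1 h2
      _ = (c + d) + 2 * (l : ℝ≥0∞) ^ 2 * ENNReal.ofReal ε := by ring
      _ ≤ 1 + 2 * (l : ℝ≥0∞) ^ 2 * ENNReal.ofReal ε := by gcongr
      _ = _ := by
          rw [ENNReal.ofReal_add (by norm_num) (by positivity), ENNReal.ofReal_mul (by positivity),
            ENNReal.ofReal_mul (by positivity), ENNReal.ofReal_pow (by positivity)]
          simp
  calc p + q ≤ (A.output P true).toReal + (A.output Q false).toReal := add_le_add h.1 h.2
    _ = (A.output P true + A.output Q false).toReal :=
        (ENNReal.toReal_add (PMF.apply_ne_top _ _) (PMF.apply_ne_top _ _)).symm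
    _ ≤ _ := ENNReal.toReal_le_of_le_ofReal (by positivity) h3

/-! ### Entries of a Haar random unitary matrix -/

/-- A real unit vector `f` other than the standard basis vector `e_i` is the `i`-th row of a unitary
matrix, namely of the Householder reflection along `e_i - f`. -/
lemma exists_unitary_row_eq {m : ℕ} (i : Fin m) (f : Fin m → ℝ) (hf : ∑ k, f k ^ 2 = 1)
    (hi : f i ≠ 1) :
    ∃ V : Matrix.unitaryGroup (Fin m) ℂ, ∀ k, (V : Matrix (Fin m) (Fin m) ℂ) i k = f k := by
  have hne : (1 : ℂ) - f i ≠ 0 := by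
    rw [sub_ne_zero]
    exact_mod_cast hi.symm
  let w : Fin m → ℂ := fun k => ((if k = i then 1 else 0 : ℝ) - f k : ℝ)
  let V : Matrix (Fin m) (Fin m) ℂ := 1 - (1 - (f i : ℂ))⁻¹ • Matrix.vecMulVec w w
  have hww : w ⬝ᵥ w = 2 * (1 - f i) := by
    have : ∑ k, ((if k = i then 1 else 0 : ℝ) - f k) * ((if k = i then 1 else 0 : ℝ) - f k)
        = 2 * (1 - f i) := by
      have : ∀ k, ((if k = i then 1 else 0 : ℝ) - f k) * ((if k = i then 1 else 0 : ℝ) - f k)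
          = (if k = i then 1 - 2 * f k else 0) + f k ^ 2 := fun k => by split_ifs <;> ring
      simp only [this, Finset.sum_add_distrib, hf, Finset.sum_ite_eq', Finset.mem_univ, if_true]
      ring
    simp only [dotProduct, w]
    exact_mod_cast this
  have hsw : star w = w := by
    funext k
    simp only [w, Pi.star_apply, Complex.star_def, Complex.conj_ofReal]
  have hsr : star ((1 - (f i : ℂ))⁻¹) = (1 - (f i : ℂ))⁻¹ := by
    simp
  have hstar : star V = V := by
    simp only [V, star_sub, star_one, star_smul, hsr, Matrix.star_eq_conjTranspose,
      Matrix.conjTranspose_vecMulVec, hsw]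
  have hV : V ∈ Matrix.unitaryGroup (Fin m) ℂ := by
    rw [Matrix.mem_unitaryGroup_iff, hstar]
    simp only [V, sub_mul, mul_sub, one_mul, mul_one, Matrix.smul_mul, Matrix.mul_smul,
      Matrix.vecMulVec_mul_vecMulVec, hww]
    ext a b
    simp [Matrix.vecMulVec_apply]
    field_simp
    ring
  refine ⟨⟨V, hV⟩, fun k => ?_⟩
  change V i k = f k
  simp only [V, Matrix.sub_apply, Matrix.smul_apply, Matrix.vecMulVec_apply, w, Matrix.one_apply,
    smul_eq_mul]
  by_cases hk : k = i
  · subst hk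
    simp
    field_simp
    ring
  · simp [hk, Ne.symm hk]
    field_simp

/-- Hoeffding's bound on the moment generating function of a Rademacher sum, multiplied by the
number of sign patterns. -/
lemma sum_signs_exp_le {ι : Type} [Fintype ι] [DecidableEq ι] (x : ι → ℝ) :
    ∑ s : ι → Bool, Real.exp (∑ k, (if s k then 1 else -1) * x k) ≤
      2 ^ Fintype.card ι * Real.exp ((∑ k, x k ^ 2) / 2) := by
  have h : ∑ s : ι → Bool, Real.exp (∑ k, (if s k then 1 else -1) * x k) =
      ∏ k, (2 * Real.cosh (x k)) := by
    simp only [Real.exp_sum]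
    rw [← Fintype.piFinset_univ,
      ← Finset.prod_univ_sum (fun _ => Finset.univ)
        (fun k (b : Bool) => Real.exp ((if b then 1 else -1) * x k))]
    refine Finset.prod_congr rfl fun k _ => ?_
    rw [Fintype.sum_bool, Real.cosh_eq]
    simp
    ring
  rw [h, Finset.prod_mul_distrib, Finset.prod_const, Finset.card_univ, Finset.sum_div,
    Real.exp_sum]
  gcongr with k _
  exact Real.cosh_le_exp_half_sq _

lemma sum_norm_sq_column {m : ℕ} (U : Matrix.unitaryGroup (Fin m) ℂ) (j : Fin m) :
    ∑ k, ‖(U : Matrix (Fin m) (Fin m) ℂ) k j‖ ^ 2 = 1 := by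
  have hU := congrFun (congrFun (Matrix.mem_unitaryGroup_iff'.1 U.2) j) j
  rw [Matrix.mul_apply, Matrix.one_apply_eq] at hU
  have : ∀ k, star (U : Matrix (Fin m) (Fin m) ℂ) j k * (U : Matrix (Fin m) (Fin m) ℂ) k j =
      ((‖(U : Matrix (Fin m) (Fin m) ℂ) k j‖ ^ 2 : ℝ) : ℂ) := fun k => by
    rw [Matrix.star_apply, Complex.star_def, mul_comm, Complex.mul_conj, Complex.normSq_eq_norm_sq]
  simp only [this] at hU
  exact_mod_cast hU

instance (m : ℕ) : (haar m).IsMulLeftInvariant :=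
  inferInstanceAs (Measure.haarMeasure _).IsMulLeftInvariant

instance (m : ℕ) : IsProbabilityMeasure (haar m) :=
  ⟨Measure.haarMeasure_self⟩

lemma measurable_exp_entry {m : ℕ} (i j : Fin m) (c : ℂ) (t : ℝ) :
    Measurable fun U : Matrix.unitaryGroup (Fin m) ℂ =>
      ENNReal.ofReal (Real.exp (t * (c * (U : Matrix (Fin m) (Fin m) ℂ) i j).re)) :=
  ENNReal.measurable_ofReal.comp (Continuous.measurable (Real.continuous_exp.comp
    (continuous_const.mul (Complex.continuous_re.comp
      (continuous_const.mul (continuous_subtype_val.matrix_elem i j))))))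

/-- The real part of an entry of a Haar random unitary matrix, rotated by a phase `c`, is
sub-Gaussian with variance proxy `1 / m`. -/
lemma lintegral_exp_entry_le {m : ℕ} (hm : 2 ≤ m) (i j : Fin m) (c : ℂ) (hc : ‖c‖ = 1) (t : ℝ) :
    ∫⁻ U, ENNReal.ofReal (Real.exp (t * (c * (U : Matrix (Fin m) (Fin m) ℂ) i j).re)) ∂(haar m) ≤
      ENNReal.ofReal (Real.exp (t ^ 2 / (2 * m))) := by
  have hm0 : (0 : ℝ) < m := by positivity
  have hm1 : 1 < √(m : ℝ) := by
    rw [Real.lt_sqrt (by norm_num)]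
    norm_num
    omega
  -- For `m = 1` the vector of signs could be `e_i` itself, where the reflection is not defined.
  have hV : ∀ s : Fin m → Bool, ∃ V : Matrix.unitaryGroup (Fin m) ℂ, ∀ k,
      (V : Matrix (Fin m) (Fin m) ℂ) i k = (((if s k then 1 else -1) / √(m : ℝ) : ℝ) : ℂ) := by
    intro s
    refine exists_unitary_row_eq i (fun k => (if s k then 1 else -1) / √(m : ℝ)) ?_ ?_
    · have : ∀ k, ((if s k then 1 else -1) / √(m : ℝ) : ℝ) ^ 2 = (m : ℝ)⁻¹ := fun k => by
        rw [div_pow, Real.sq_sqrt hm0.le]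
        split_ifs <;> simp
      simp [this, hm0.ne']
    · intro h
      have h2 : (if s i then 1 else -1 : ℝ) = √(m : ℝ) := by
        field_simp at h
        exact h
      split_ifs at h2 <;> linarith
  choose V hV using hV
  set F : Matrix.unitaryGroup (Fin m) ℂ → ℝ≥0∞ := fun U =>
    ENNReal.ofReal (Real.exp (t * (c * (U : Matrix (Fin m) (Fin m) ℂ) i j).re)) with hF
  have hFm : Measurable F := measurable_exp_entry i j c t
  have hpt : ∀ U : Matrix.unitaryGroup (Fin m) ℂ, ∑ s, F (V s * U) ≤
      2 ^ m * ENNReal.ofReal (Real.exp (t ^ 2 / (2 * m))) := by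
    intro U
    set x : Fin m → ℝ := fun k =>
      t * (c * (U : Matrix (Fin m) (Fin m) ℂ) k j).re / √(m : ℝ) with hx
    have h1 : ∀ s, F (V s * U) =
        ENNReal.ofReal (Real.exp (∑ k, (if s k then 1 else -1) * x k)) := by
      intro s
      simp only [hF, Submonoid.coe_mul, Matrix.mul_apply, hV, hx, Finset.mul_sum, Complex.re_sum]
      congr 2
      refine Finset.sum_congr rfl fun k _ => ?_
      rw [mul_left_comm c, Complex.re_ofReal_mul]
      ring
    have h2 : ∑ k, x k ^ 2 ≤ t ^ 2 / m := by
      calc ∑ k, x k ^ 2 ≤ ∑ k, t ^ 2 / m * ‖(U : Matrix (Fin m) (Fin m) ℂ) k j‖ ^ 2 := by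
            refine Finset.sum_le_sum fun k _ => ?_
            have h3 : (c * (U : Matrix (Fin m) (Fin m) ℂ) k j).re ^ 2 ≤
                ‖(U : Matrix (Fin m) (Fin m) ℂ) k j‖ ^ 2 := by
              have := Complex.abs_re_le_norm (c * (U : Matrix (Fin m) (Fin m) ℂ) k j)
              rw [norm_mul, hc, one_mul] at this
              exact sq_le_sq' (abs_le.1 this).1 (abs_le.1 this).2
            rw [hx, div_pow, mul_pow, Real.sq_sqrt hm0.le, mul_div_right_comm]
            gcongr
        _ = t ^ 2 / m := by rw [← Finset.mul_sum, sum_norm_sq_column, mul_one]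
    simp only [h1]
    rw [← ENNReal.ofReal_sum_of_nonneg fun _ _ => (Real.exp_pos _).le]
    refine (ENNReal.ofReal_le_ofReal (sum_signs_exp_le x)).trans ?_
    rw [ENNReal.ofReal_mul (by positivity), ENNReal.ofReal_pow (by norm_num), Fintype.card_fin]
    simp only [ENNReal.ofReal_ofNat]
    rw [show t ^ 2 / (2 * m) = t ^ 2 / m / 2 by rw [div_div, mul_comm (m : ℝ)]]
    gcongr
  -- Left invariance under each of the `2 ^ m` unitaries `V s`, then the pointwise bound on the sum.
  have hmul : 2 ^ m * ∫⁻ U, F U ∂(haar m) ≤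
      2 ^ m * ENNReal.ofReal (Real.exp (t ^ 2 / (2 * m))) := by
    calc 2 ^ m * ∫⁻ U, F U ∂(haar m) = ∑ s : Fin m → Bool, ∫⁻ U, F (V s * U) ∂(haar m) := by
          simp [lintegral_mul_left_eq_self]
      _ = ∫⁻ U, ∑ s : Fin m → Bool, F (V s * U) ∂(haar m) :=
          (lintegral_finsetSum _ fun s _ => hFm.comp (measurable_const_mul (V s))).symm
      _ ≤ ∫⁻ _, 2 ^ m * ENNReal.ofReal (Real.exp (t ^ 2 / (2 * m))) ∂(haar m) :=
          lintegral_mono hpt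
      _ = _ := by simp
  exact (ENNReal.mul_le_mul_iff_right (by simp) (by simp)).1 hmul

/-- The Chernoff bound resulting from `lintegral_exp_entry_le` with the optimal parameter
`t = m s`. -/
lemma haar_re_entry_ge_le {m : ℕ} (hm : 2 ≤ m) (i j : Fin m) (c : ℂ) (hc : ‖c‖ = 1) {s : ℝ}
    (hs : 0 ≤ s) :
    haar m {U | s ≤ (c * (U : Matrix (Fin m) (Fin m) ℂ) i j).re} ≤
      ENNReal.ofReal (Real.exp (-(m * s ^ 2 / 2))) := by
  have hm0 : (0 : ℝ) < m := by positivity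
  calc haar m {U | s ≤ (c * (U : Matrix (Fin m) (Fin m) ℂ) i j).re}
      ≤ haar m {U | ENNReal.ofReal (Real.exp (m * s ^ 2)) ≤ ENNReal.ofReal
          (Real.exp ((m * s) * (c * (U : Matrix (Fin m) (Fin m) ℂ) i j).re))} := by
        refine measure_mono fun U (hU : s ≤ _) => ?_
        refine ENNReal.ofReal_le_ofReal (Real.exp_le_exp.2 ?_)
        rw [sq, ← mul_assoc]
        gcongr
    _ ≤ (∫⁻ U, ENNReal.ofReal (Real.exp ((m * s) * (c * (U : Matrix (Fin m) (Fin m) ℂ) i j).re))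
          ∂(haar m)) / ENNReal.ofReal (Real.exp (m * s ^ 2)) :=
        meas_ge_le_lintegral_div (measurable_exp_entry i j c _).aemeasurable (by simp [Real.exp_pos]) (by simp)
    _ ≤ ENNReal.ofReal (Real.exp ((m * s) ^ 2 / (2 * m))) /
          ENNReal.ofReal (Real.exp (m * s ^ 2)) := by
        gcongr
        exact lintegral_exp_entry_le hm i j c hc _
    _ = _ := by
        rw [← ENNReal.ofReal_div_of_pos (Real.exp_pos _), ← Real.exp_sub]
        congr 2
        field_simp
        ring

/-- With high probability all entries of a Haar random unitary matrix are small. -/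
theorem haar_exists_lt_norm_entry_le {m : ℕ} (hm : 2 ≤ m) {b : ℝ} (hb : 0 ≤ b) :
    haar m {U | ∃ i j, b < ‖(U : Matrix (Fin m) (Fin m) ℂ) i j‖} ≤
      ENNReal.ofReal (4 * m ^ 2 * Real.exp (-(m * b ^ 2 / 8))) := by
  -- If `‖z‖ > b`, then one of `±re z`, `±im z`, that is, one of the four numbers
  -- `re (I ^ r * z)`, is at least `b / 2`.
  have hsub : {U : Matrix.unitaryGroup (Fin m) ℂ |
        ∃ i j, b < ‖(U : Matrix (Fin m) (Fin m) ℂ) i j‖} ⊆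
      ⋃ i, ⋃ j, ⋃ r : Fin 4, {U : Matrix.unitaryGroup (Fin m) ℂ |
        b / 2 ≤ (Complex.I ^ (r : ℕ) * (U : Matrix (Fin m) (Fin m) ℂ) i j).re} := by
    rintro U ⟨i, j, hij⟩
    simp only [Set.mem_iUnion, Set.mem_ofPred_eq]
    refine ⟨i, j, ?_⟩
    by_contra! hcon
    have h0 := hcon 0
    have h1 := hcon 1
    have h2 := hcon 2
    have h3 := hcon 3
    simp [pow_succ] at h0 h1 h2 h3
    have := Complex.norm_le_abs_re_add_abs_im ((U : Matrix (Fin m) (Fin m) ℂ) i j)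
    have hre : |((U : Matrix (Fin m) (Fin m) ℂ) i j).re| ≤ b / 2 := abs_le.2 ⟨by linarith, h0.le⟩
    have him : |((U : Matrix (Fin m) (Fin m) ℂ) i j).im| ≤ b / 2 :=
      abs_le.2 ⟨by linarith, by linarith⟩
    linarith
  refine (measure_mono hsub).trans ?_
  calc _ ≤ ∑ i : Fin m, ∑ j : Fin m, ∑ r : Fin 4, haar m {U |
        b / 2 ≤ (Complex.I ^ (r : ℕ) * (U : Matrix (Fin m) (Fin m) ℂ) i j).re} := by
        refine (measure_iUnion_fintype_le _ _).trans (Finset.sum_le_sum fun i _ => ?_)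
        refine (measure_iUnion_fintype_le _ _).trans (Finset.sum_le_sum fun j _ => ?_)
        exact measure_iUnion_fintype_le _ _
    _ ≤ ∑ i : Fin m, ∑ j : Fin m, ∑ r : Fin 4,
          ENNReal.ofReal (Real.exp (-(m * (b / 2) ^ 2 / 2))) := by
        gcongr with i _ j _ r _
        exact haar_re_entry_ge_le hm i j _ (by simp) (by positivity)
    _ = _ := by
        simp only [Finset.sum_const, Finset.card_univ, Fintype.card_fin, nsmul_eq_mul]
        rw [ENNReal.ofReal_mul (by positivity), ENNReal.ofReal_mul (by positivity),
          ENNReal.ofReal_pow (by positivity)]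
        simp only [ENNReal.ofReal_ofNat, ENNReal.ofReal_natCast]
        rw [show (m * (b / 2) ^ 2 / 2 : ℝ) = m * b ^ 2 / 8 by ring]
        push_cast
        ring

/-! ### Flatness of the Boson-Sampling distribution -/

lemma norm_permanent_le {n : ℕ} (M : Matrix (Fin n) (Fin n) ℂ) {b : ℝ}
    (hM : ∀ i j, ‖M i j‖ ≤ b) : ‖M.permanent‖ ≤ n.factorial * b ^ n := by
  calc ‖M.permanent‖ ≤ ∑ σ : Equiv.Perm (Fin n), ‖∏ i, M (σ i) i‖ := norm_sum_le _ _
    _ ≤ ∑ σ : Equiv.Perm (Fin n), b ^ n := by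
        refine Finset.sum_le_sum fun σ _ => ?_
        rw [norm_prod]
        calc ∏ i, ‖M (σ i) i‖ ≤ ∏ _i : Fin n, b :=
              Finset.prod_le_prod (fun _ _ => norm_nonneg _) fun i _ => hM _ _
          _ = b ^ n := by simp
    _ = n.factorial * b ^ n := by simp [Fintype.card_perm]

lemma outcomeProb_le {m n : ℕ} (h : n ≤ m) (U : Matrix.unitaryGroup (Fin m) ℂ) {b : ℝ}
    (hU : ∀ i j, ‖(U : Matrix (Fin m) (Fin m) ℂ) i j‖ ≤ b) (S : Outcome m n) :
    outcomeProb h U S ≤ (n.factorial * b ^ n) ^ 2 := by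
  have h1 : (1 : ℝ) ≤ ∏ j, ((S.1 j).factorial : ℝ) := by
    exact_mod_cast Nat.one_le_iff_ne_zero.2
      (Finset.prod_ne_zero_iff.2 fun j _ => (S.1 j).factorial_ne_zero)
  refine (div_le_self (by positivity) h1).trans ?_
  gcongr
  exact norm_permanent_le _ fun i j => hU _ _

/-- The uniform distribution has the smallest largest probability of all distributions. -/
lemma uniform_apply_le {m n : ℕ} (h : n ≤ m) {P : PMF (Outcome m n)} {ε : ℝ≥0∞}
    (hP : ∀ S, P S ≤ ε) (S : Outcome m n) : uniform h S ≤ ε := by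
  have : Nonempty (Outcome m n) := ⟨initialOutcome h⟩
  have h1 : (1 : ℝ≥0∞) ≤ ε * Fintype.card (Outcome m n) := by
    rw [← P.tsum_coe, tsum_fintype]
    calc ∑ S, P S ≤ ∑ _S : Outcome m n, ε := Finset.sum_le_sum fun S _ => hP S
      _ = _ := by simp [mul_comm]
  rw [uniform, PMF.uniformOfFintype_apply, ← one_div]
  exact ENNReal.div_le_of_le_mul h1

lemma distribution_le {m n : ℕ} (hn : 0 < n) (h : n ≤ m) (U : Matrix.unitaryGroup (Fin m) ℂ)
    (hU : ∀ i j, ‖(U : Matrix (Fin m) (Fin m) ℂ) i j‖ ≤ Real.exp (-1) / n) (S : Outcome m n) :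
    distribution h U S ≤ ENNReal.ofReal (Real.exp (-2 * n)) := by
  have hn' : (0 : ℝ) < n := by exact_mod_cast hn
  refine ENNReal.ofReal_le_ofReal ((outcomeProb_le h U hU S).trans ?_)
  calc (n.factorial * (Real.exp (-1) / n) ^ n) ^ 2 ≤ ((n : ℝ) ^ n * (Real.exp (-1) / n) ^ n) ^ 2 := by
        gcongr
        exact_mod_cast n.factorial_le_pow
    _ = Real.exp (-2 * n) := by
        rw [← mul_pow, mul_div_cancel₀ _ hn'.ne', ← Real.exp_nat_mul, ← Real.exp_nat_mul]
        congr 1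
        push_cast
        ring

/-- The bound of `haar_exists_lt_norm_entry_le` for `b = e^{-1} / n` is supra-exponentially small
in `n`. -/
lemma eventually_tail_le {ν : ℝ} (hν : 3 < ν) {m : ℕ → ℕ}
    (hm : (fun n : ℕ => (n : ℝ) ^ ν) =O[atTop] (fun n : ℕ => (m n : ℝ))) (C : ℝ) :
    ∀ᶠ n : ℕ in atTop, 4 * (m n : ℝ) ^ 2 * Real.exp (-(m n * (Real.exp (-1) / n) ^ 2 / 8)) ≤
      Real.exp (-(C * n)) := by
  obtain ⟨K, hK, hKm⟩ := hm.exists_pos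
  rw [IsBigOWith_def] at hKm
  have hlim : Tendsto (fun n : ℕ => (n : ℝ) ^ (ν - 3)) atTop atTop :=
    (tendsto_rpow_atTop (by linarith)).comp tendsto_natCast_atTop_atTop
  have hlin : Tendsto (fun n : ℕ => (n : ℝ)) atTop atTop := tendsto_natCast_atTop_atTop
  set B : ℝ := 4 * (8 * Real.exp 2) ^ 2 * 8 * 24 with hB
  filter_upwards [hKm, hlim.eventually_ge_atTop (16 * Real.exp 2 * K * (C + 2)),
    hlin.eventually_ge_atTop (Real.log B), eventually_gt_atTop 0] with n h1 h2 h3 hn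
  have hn' : (0 : ℝ) < n := by exact_mod_cast hn
  set s : ℝ := m n * (Real.exp (-1) / n) ^ 2 / 8 with hs
  have hs0 : 0 ≤ s := by positivity
  have hee : Real.exp (-1) ^ 2 * Real.exp 2 = 1 := by
    rw [← Real.exp_nat_mul, ← Real.exp_add]
    norm_num
  have hms : (m n : ℝ) = 8 * Real.exp 2 * n ^ 2 * s := by
    rw [hs]
    field_simp
    linear_combination (-(m n : ℝ)) * hee
  have hsn : (C + 2) * n ≤ s / 2 := by
    rw [Real.norm_of_nonneg (by positivity), Real.norm_of_nonneg (by positivity)] at h1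
    have h4 : (n : ℝ) ^ ν = n ^ (ν - 3) * n ^ 3 := by
      rw [← Real.rpow_natCast, ← Real.rpow_add hn']
      norm_num
    rw [h4, hms] at h1
    have h5 : (16 * Real.exp 2 * K * (C + 2)) * (n : ℝ) ^ 3 ≤
        K * (8 * Real.exp 2 * n ^ 2 * s) := (by gcongr : _ ≤ (n : ℝ) ^ (ν - 3) * n ^ 3).trans h1
    have hpos : 0 < 16 * Real.exp 2 * K * (n : ℝ) ^ 2 := by positivity
    refine le_of_mul_le_mul_left ?_ hpos
    linarith
  -- Half of the exponent `s` absorbs the factor `s ^ 2` that comes from `m ^ 2`; the other half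
  -- is at least `(C + 2) * n` and also absorbs `n ^ 4` and the constants.
  have hexp2 : s ^ 2 ≤ 8 * Real.exp (s / 2) := by
    have := Real.pow_div_factorial_le_exp (s / 2) (by positivity) 2
    norm_num [Nat.factorial] at this
    linarith
  have hexp4 : (n : ℝ) ^ 4 ≤ 24 * Real.exp n := by
    have := Real.pow_div_factorial_le_exp (n : ℝ) hn'.le 4
    norm_num [Nat.factorial] at this
    linarith
  have hBn : B ≤ Real.exp n := by
    rw [← Real.exp_log (show 0 < B by positivity)]
    exact Real.exp_le_exp.2 h3
  calc 4 * (m n : ℝ) ^ 2 * Real.exp (-s)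
      = 4 * (8 * Real.exp 2) ^ 2 * (n : ℝ) ^ 4 * s ^ 2 * Real.exp (-s) := by rw [hms]; ring
    _ ≤ 4 * (8 * Real.exp 2) ^ 2 * (24 * Real.exp n) * (8 * Real.exp (s / 2)) * Real.exp (-s) := by
        gcongr
    _ = B * Real.exp (n - s / 2) := by
        rw [show (n : ℝ) - s / 2 = n + s / 2 + -s by ring, Real.exp_add, Real.exp_add, hB]
        ring
    _ ≤ Real.exp n * Real.exp (n - s / 2) := by gcongr
    _ ≤ Real.exp (-(C * n)) := by
        rw [← Real.exp_add]
        exact Real.exp_le_exp.2 (by linarith)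

lemma eventually_le_modes {ν : ℝ} (hν : 3 < ν) {m : ℕ → ℕ}
    (hm : (fun n : ℕ => (n : ℝ) ^ ν) =O[atTop] (fun n : ℕ => (m n : ℝ))) :
    ∀ᶠ n : ℕ in atTop, n ≤ m n := by
  obtain ⟨K, hK, hKm⟩ := hm.exists_pos
  rw [IsBigOWith_def] at hKm
  have hlim : Tendsto (fun n : ℕ => (n : ℝ) ^ (ν - 1)) atTop atTop :=
    (tendsto_rpow_atTop (by linarith)).comp tendsto_natCast_atTop_atTop
  filter_upwards [hKm, hlim.eventually_ge_atTop K, eventually_gt_atTop 0] with n h1 h2 hn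
  have hn' : (0 : ℝ) < n := by exact_mod_cast hn
  rw [Real.norm_of_nonneg (by positivity), Real.norm_of_nonneg (by positivity)] at h1
  have h4 : (n : ℝ) ^ ν = n ^ (ν - 1) * n := by
    rw [← Real.rpow_add_one hn'.ne']
    norm_num
  have h5 : K * n ≤ K * m n := by
    calc K * n ≤ (n : ℝ) ^ (ν - 1) * n := by gcongr
      _ ≤ _ := h4 ▸ h1
  exact_mod_cast le_of_mul_le_mul_left h5 hK

end BosonSampling

theorem theorem2 (ν : ℝ) (hν : 3 < ν) (m : ℕ → ℕ)
    (hm : (fun n : ℕ => (n : ℝ) ^ ν) =O[atTop] (fun n : ℕ => (m n : ℝ)))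
    (p q : ℝ) (hpq : 1 < p + q) (a : ℝ) (ha : 0 < a) (C : ℝ) (hC : 0 < C) :
    ∀ᶠ n : ℕ in atTop, ∃ h : n ≤ m n,
      BosonSampling.haar (m n)
          {U | ∃ l : ℕ, (l : ℝ) ≤ a * Real.exp ((n : ℝ) / 2) ∧
            ∃ A : BosonSampling.DecisionAlgorithm (BosonSampling.Outcome (m n) n) l,
              A.IsSymmetric ∧
                A.Distinguishes p q (BosonSampling.distribution h U) (BosonSampling.uniform h)} ≤
        ENNReal.ofReal (Real.exp (-(C * n))) := by
  have hlim : Tendsto (fun n : ℕ => 1 + 2 * a ^ 2 * Real.exp (-(n : ℝ))) atTop (nhds 1) := by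
    have := (Real.tendsto_exp_neg_atTop_nhds_zero.comp tendsto_natCast_atTop_atTop).const_mul
      (2 * a ^ 2) |>.const_add 1
    simpa using this
  filter_upwards [BosonSampling.eventually_le_modes hν hm,
    BosonSampling.eventually_tail_le hν hm C, hlim.eventually_lt_const hpq,
    eventually_ge_atTop 2] with n hnm htail hcoll hn
  refine ⟨hnm, (measure_mono ?_).trans ((BosonSampling.haar_exists_lt_norm_entry_le
    (hn.trans hnm) (b := Real.exp (-1) / n) (by positivity)).trans
    (ENNReal.ofReal_le_ofReal htail))⟩
  rintro U ⟨l, hl, A, hA, hdist⟩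
  -- If all entries are small, both distributions are bounded by `e^{-2n}`, which contradicts
  -- `1 < p + q`.
  by_contra hU
  simp only [Set.mem_ofPred_eq, not_exists, not_lt] at hU
  have hD := BosonSampling.distribution_le (by omega) hnm U hU
  have hle := hdist.add_le hA (Real.exp_pos _).le hD (BosonSampling.uniform_apply_le hnm hD)
  have hl2 : 2 * (l : ℝ) ^ 2 * Real.exp (-2 * n) ≤ 2 * a ^ 2 * Real.exp (-(n : ℝ)) := by
    calc 2 * (l : ℝ) ^ 2 * Real.exp (-2 * n)
        ≤ 2 * (a * Real.exp ((n : ℝ) / 2)) ^ 2 * Real.exp (-2 * n) := by gcongr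
      _ = 2 * a ^ 2 * Real.exp (-(n : ℝ)) := by
          rw [mul_pow, ← Real.exp_nat_mul, mul_assoc, mul_assoc, ← Real.exp_add, ← mul_assoc]
          congr 2
          push_cast
          ring
  linarith
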